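/- Let $\mathbb H^3$ be hyperbolic three-space (curvature $-1$) with conformal boundary two-sphere $S^2_\infty$, and let $(A,\Phi)$ be a smooth $SU(2)$ hyperbolic monopole of mass $m>0$ on the trivial rank two Hermitian bundle $E$ over $\mathbb H^3$: $d_A\Phi=*F_A$, $F_A\in L^2$, and $\|\Phi\|\to m$ at infinity, where $\|\Phi\|$ is the operator norm (so $\|\Phi\|=\mu$ if $\Phi$ has eigenvalues $\pm i\mu$, $\mu\ge 0$). Assume that the monopole is nontrivial, i.e. that $F_A$ is not identically zero. For $a\ne b$ in $S^2_\infty$ let $t\mapsto\gamma_{ab}(t)$ be the geodesic, parametrised by arc length, that runs from $a$ to $b$. Let $s_{ab}$, $r_{ab}$ be solutions along $\gamma_{ab}$ of $$(\partial_t^A-i\Phi)s=0,\qquad(\partial_t^A+i\Phi)r=0,\qquad \lim_{t\to\infty}e^{mt}\|s_{ab}(t)\|=1,\qquad \lim_{t\to-\infty}e^{-mt}\|r_{ab}(t)\|=1 .$$ The inner product $(r_{ab},s_{ab})=(r_{ab}(t),s_{ab}(t))$ does not depend on $t$. For $z_1,\dots,z_n\in S^2_\infty$ with $z_i\neq z_{i+1}$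 for $1\le i<n$ and $z_n\ne z_1$ (so $n\ge 2$), with indices taken cyclically, the $n$-point function is $$\langle P_{z_1}\cdots P_{z_n}\rangle=\prod_{i=1}^n (r_{z_iz_{i+1}},s_{z_iz_{i+1}}),$$ where the phases are aligned so that, for each $i$, $\lim_{t\to\infty}e^{mt}s_{z_{i-1}z_i}(t)=\lim_{t\to-\infty}e^{-mt}r_{z_iz_{i+1}}(t)$ in the fibre of $E$ over the boundary point $z_i$. (Fibres over points of the two geodesics near $z_i$ are compared by parallel transport along the short segments, straight in the ball model, that join them.) It is extended to all nonempty tuples by cyclic invariance, $\langle P_z\rangle=1$ and $\langle P_zP_zP_{z_3}\cdots P_{z_n}\rangle=\langle P_zP_{z_3}\cdots P_{z_n}\rangle$ for $n\ge 2$ (so that $\langle P_zP_z\rangle=1$). Then: 1. Whenever $z_i\ne z_{i+1}$ for $1\le i<n$ and $z_n\neq z_1$, one has $|\langle P_{z_1}\cdots P_{z_n}\rangle|<1$, that is, every value given by a choice of solutions as above has modulus less than $1$. 2. Let $\mathcal A$ be an involutive algebra over $\mathbb C$ with elements $P_z=P_z^*$ $(z\in S^2_\infty)$ and a linear functional $\langle\cdot\rangle:\mathcal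 A\to\mathbb C$ with $\langle a^*\rangle=\overline{\langle a\rangle}$ whose value on each product $P_{z_1}\cdots P_{z_n}$, $n\ge1$, is the value of the $n$-point function of $(A,\Phi)$; the boundary algebra of $(A,\Phi)$, which carries derivations and satisfies further relations, is such an algebra. Then $P_{z_1}\neq P_{z_2}$ in $\mathcal A$ whenever $z_1\ne z_2$. -/

import Mathlib

open Filter Topology Set MeasureTheory

noncomputable section

/-- Euclidean three-space; hyperbolic three-space is its open unit ball with the metric
`4 |dx|² / (1 - |x|²)²` of constant curvature `-1`. -/
abbrev E3 : Type := EuclideanSpace ℝ (Fin 3)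

/-- The fibre of the trivial rank two Hermitian bundle. -/
abbrev Fibre : Type := EuclideanSpace ℂ (Fin 2)

/-- Endomorphisms of the fibre, with the operator norm. For an element of `su(2)` with eigenvalues
`± i μ` this norm is `|μ|`. -/
abbrev EndF : Type := Fibre →L[ℂ] Fibre

/-- The Lie algebra `su(2)`: skew-adjoint endomorphisms of trace zero. -/
def su2 : Set EndF :=
  {X | star X = -X ∧ LinearMap.trace ℂ Fibre (X : Fibre →ₗ[ℂ] Fibre) = 0}

/-- Hyperbolic three-space in the ball model. -/
def hyperbolicBall : Set E3 := Metric.ball 0 1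

/-- The conformal boundary two-sphere. -/
abbrev Boundary : Type := Metric.sphere (0 : E3) 1

/-- The standard orthonormal basis vectors of Euclidean space. -/
def stdVec (i : Fin 3) : E3 := EuclideanSpace.single i (1 : ℝ)

/-- `λ⁻¹ = (1 - |x|²) / 2`, where the hyperbolic metric is `λ²` times the Euclidean one. -/
def invConformalFactor (x : E3) : ℝ := (1 - ‖x‖ ^ 2) / 2

/-- Curvature `F_A(u, v) = dA(u, v) + [A(u), A(v)]` of the connection `d + A`. -/
def curvature (A : E3 → E3 →L[ℝ] EndF) (x u v : E3) : EndF :=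
  fderiv ℝ A x u v - fderiv ℝ A x v u + (A x u * A x v - A x v * A x u)

/-- Covariant derivative `d_A Φ (u) = dΦ(u) + [A(u), Φ]`. -/
def covDeriv (A : E3 → E3 →L[ℝ] EndF) (Φ : E3 → EndF) (x u : E3) : EndF :=
  fderiv ℝ Φ x u + (A x u * Φ x - Φ x * A x u)

/-- An `SU(2)` monopole on hyperbolic three-space, of positive mass. The connection and the Higgs
field are smooth on the ball; their values outside the ball play no role. -/
structure HyperbolicMonopole where
  /-- the mass -/
  mass : ℝ
  mass_pos : 0 < mass
  /-- the connection form -/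
  A : E3 → E3 →L[ℝ] EndF
  /-- the Higgs field -/
  Φ : E3 → EndF
  smooth_A : ContDiffOn ℝ (⊤ : ℕ∞) A hyperbolicBall
  smooth_Φ : ContDiffOn ℝ (⊤ : ℕ∞) Φ hyperbolicBall
  A_mem : ∀ x ∈ hyperbolicBall, ∀ u, A x u ∈ su2
  Φ_mem : ∀ x ∈ hyperbolicBall, Φ x ∈ su2
  /-- `d_A Φ = * F_A`. On two-forms in dimension three the Hodge star of `λ² |dx|²` is `λ⁻¹` times
  the Euclidean one; `i, i + 1, i + 2` is a cyclic permutation of the three coordinates. -/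
  bogomolny : ∀ x ∈ hyperbolicBall, ∀ i : Fin 3,
    covDeriv A Φ x (stdVec i) =
      invConformalFactor x • curvature A x (stdVec (i + 1)) (stdVec (i + 2))
  /-- `F_A` is square integrable: `|F|² dvol = λ⁻⁴ |F|²_eucl λ³ dx = λ⁻¹ |F|²_eucl dx`. -/
  curvature_L2 : IntegrableOn
    (fun x => invConformalFactor x *
      ∑ i : Fin 3, ‖curvature A x (stdVec (i + 1)) (stdVec (i + 2))‖ ^ 2) hyperbolicBall volume
  /-- `|Φ| → mass` at infinity, that is, as `|x| ↑ 1`. -/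
  tendsto_norm_Φ : Tendsto (fun x => ‖Φ x‖) (comap (fun x : E3 => ‖x‖) (𝓝[<] 1)) (𝓝 mass)

/-- The hyperbolic geodesic from the boundary point `a` to the boundary point `b ≠ a`, with unit
hyperbolic speed: it tends to `b` as `t → ∞` and to `a` as `t → -∞`. -/
def geodesic (a b : Boundary) (t : ℝ) : E3 :=
  (Real.exp t + Real.exp (-t) + ‖(b : E3) - a‖)⁻¹ •
    (Real.exp t • (b : E3) + Real.exp (-t) • (a : E3))

namespace HyperbolicMonopole

variable (M : HyperbolicMonopole)

/-- The curvature is not identically zero, i.e. the monopole is not the trivial one. -/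
def Nontrivial : Prop :=
  ∃ x ∈ hyperbolicBall, ∃ u v : E3, curvature M.A x u v ≠ 0

/-- `s` solves `(∂_t^A - i Φ) s = 0` along the geodesic from `a` to `b`. -/
def SolvesMinus (a b : Boundary) (s : ℝ → Fibre) : Prop :=
  ∀ t, HasDerivAt s (-(M.A (geodesic a b t) (deriv (geodesic a b) t) (s t))
    + Complex.I • M.Φ (geodesic a b t) (s t)) t

/-- `r` solves `(∂_t^A + i Φ) r = 0` along the geodesic from `a` to `b`. -/
def SolvesPlus (a b : Boundary) (r : ℝ → Fibre) : Prop :=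
  ∀ t, HasDerivAt r (-(M.A (geodesic a b t) (deriv (geodesic a b) t) (r t))
    - Complex.I • M.Φ (geodesic a b t) (r t)) t

/-- `s` is a decaying solution `s₊` with `e^{mt} ‖s‖ → 1` as `t → ∞`. -/
def IsDecayingS (a b : Boundary) (s : ℝ → Fibre) : Prop :=
  M.SolvesMinus a b s ∧ Tendsto (fun t => Real.exp (M.mass * t) * ‖s t‖) atTop (𝓝 1)

/-- `r` is a decaying solution `r₊` with `e^{-mt} ‖r‖ → 1` as `t → -∞`. -/
def IsDecayingR (a b : Boundary) (r : ℝ → Fibre) : Prop :=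
  M.SolvesPlus a b r ∧ Tendsto (fun t => Real.exp (-(M.mass * t)) * ‖r t‖) atBot (𝓝 1)

/-- `w` is the parallel transport of `v` along the straight segment from `x` to `y`. -/
def IsTransport (x y : E3) (v w : Fibre) : Prop :=
  ∃ f : ℝ → Fibre, f 0 = v ∧ f 1 = w ∧ ∀ u ∈ Icc (0 : ℝ) 1,
    HasDerivWithinAt f (-(M.A (x + u • (y - x)) (y - x) (f u))) (Icc 0 1) u

/-- The solutions `s` along the geodesic from `a` to `b` and `r` along the geodesic from `b` to `c`
have the same limit `lim_{t → ∞} e^{mt} s(t) = lim_{t' → -∞} e^{-mt'} r(t')` in the fibre over the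
boundary point `b`. Both geodesics tend to `b`, and the fibres over their points are compared by
parallel transport along the segments, of vanishing length, that join them. This makes the
condition gauge invariant; in a gauge that extends continuously to the boundary it is the equality
of the two limits. -/
def Aligned (a b c : Boundary) (s r : ℝ → Fibre) : Prop :=
  ∃ w : ℝ → Fibre,
    (∀ t, M.IsTransport (geodesic a b t) (geodesic b c (-t))
      ((Real.exp (M.mass * t) : ℂ) • s t) (w t)) ∧
    Tendsto (fun t => w t - (Real.exp (M.mass * t) : ℂ) • r (-t)) atTop (𝓝 0)

/-- The inner product `(r(t), s(t))` of solutions of the two scattering equations, conjugate linear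
in `r`. It does not depend on `t` (`inner_eq_pairing`). -/
def pairing (r s : ℝ → Fibre) : ℂ := inner ℂ (r 0) (s 0)

/-- `c` is the value of the `n`-point function `⟨P_{z_1} ⋯ P_{z_n}⟩` at points with
`z_i ≠ z_{i+1}` and `z_n ≠ z_1`. Indices are cyclic: `i + 1` is computed in `Fin n`. For each `i`,
`r i` and `s i` are the decaying solutions along the geodesic from `z i` to `z (i + 1)`. -/
def IsNPointValue {n : ℕ} [NeZero n] (z : Fin n → Boundary) (c : ℂ) : Prop :=
  (∀ i, z i ≠ z (i + 1)) ∧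
  ∃ r s : Fin n → ℝ → Fibre,
    (∀ i, M.IsDecayingR (z i) (z (i + 1)) (r i)) ∧
    (∀ i, M.IsDecayingS (z i) (z (i + 1)) (s i)) ∧
    (∀ i, M.Aligned (z i) (z (i + 1)) (z (i + 1 + 1)) (s i) (r (i + 1))) ∧
    c = ∏ i, pairing (r i) (s i)

/-- The extension of the `n`-point function to all nonempty tuples: it is cyclically invariant,
`⟨P_z⟩ = 1`, and `⟨P_z P_z P_{z_3} ⋯ P_{z_n}⟩ = ⟨P_z P_{z_3} ⋯ P_{z_n}⟩`. -/
inductive Expectation : List Boundary → ℂ → Prop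
  | generic {n : ℕ} [NeZero n] (z : Fin n → Boundary) (c : ℂ) (h : M.IsNPointValue z c) :
      Expectation (List.ofFn z) c
  | one (z : Boundary) : Expectation [z] 1
  | square (z : Boundary) (l : List Boundary) (c : ℂ) (h : Expectation (z :: l) c) :
      Expectation (z :: z :: l) c
  | rotate (z : Boundary) (l : List Boundary) (c : ℂ) (h : Expectation (l ++ [z]) c) :
      Expectation (z :: l) c

end HyperbolicMonopole

/-- An involutive complex algebra `𝒜` (unital or not) with self-adjoint elements `P_z` and a linear
functional `⟨·⟩` that satisfies `⟨a*⟩ = conj ⟨a⟩` and restricts to the `n`-point function of the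
monopole on the products `P_{z_1} P_{z_2} ⋯ P_{z_n}`, `n ≥ 1`. The boundary algebra of the monopole
is such an algebra, with derivations and further relations; no use is made of these here, so that
whatever holds for all algebras of this kind holds for the boundary algebra. -/
structure ExpectationAlgebra (M : HyperbolicMonopole) (𝒜 : Type*) [NonUnitalRing 𝒜] [StarRing 𝒜]
    [Module ℂ 𝒜] [IsScalarTower ℂ 𝒜 𝒜] [SMulCommClass ℂ 𝒜 𝒜] [StarModule ℂ 𝒜] where
  /-- the generators -/
  P : Boundary → 𝒜
  star_P : ∀ z, star (P z) = P z
  /-- the expectation value -/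
  expect : 𝒜 →ₗ[ℂ] ℂ
  expect_star : ∀ a, expect (star a) = star (expect a)
  expect_word : ∀ (z : Boundary) (l : List Boundary),
    M.Expectation (z :: l) (expect (l.foldl (fun a w => a * P w) (P z)))

/-- The geodesic between distinct boundary points stays in the ball. -/
theorem geodesic_mem {a b : Boundary} (hab : a ≠ b) (t : ℝ) :
    geodesic a b t ∈ hyperbolicBall := by
  have ha : ‖(a : E3)‖ = 1 := by simp
  have hb : ‖(b : E3)‖ = 1 := by simp
  have hd : 0 < ‖(b : E3) - a‖ :=
    norm_pos_iff.2 (sub_ne_zero.2 fun h => hab (Subtype.ext h.symm))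
  have h1 := Real.exp_pos t
  have h2 := Real.exp_pos (-t)
  have hD : 0 < Real.exp t + Real.exp (-t) + ‖(b : E3) - a‖ := by positivity
  have hn : ‖Real.exp t • (b : E3) + Real.exp (-t) • (a : E3)‖ ≤ Real.exp t + Real.exp (-t) := by
    refine (norm_add_le _ _).trans (le_of_eq ?_)
    rw [norm_smul, norm_smul, ha, hb, Real.norm_of_nonneg h1.le, Real.norm_of_nonneg h2.le,
      mul_one, mul_one]
  rw [hyperbolicBall, mem_ball_zero_iff, geodesic, norm_smul, Real.norm_of_nonneg (by positivity),
    inv_mul_lt_iff₀ hD]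
  linarith

/-- The inner product of solutions of the two scattering equations is constant in `t`. -/
theorem HyperbolicMonopole.inner_eq_pairing (M : HyperbolicMonopole) {a b : Boundary} (hab : a ≠ b)
    {r s : ℝ → Fibre} (hr : M.SolvesPlus a b r) (hs : M.SolvesMinus a b s) (t : ℝ) :
    inner ℂ (r t) (s t) = HyperbolicMonopole.pairing r s := by
  have skew : ∀ X ∈ su2, ∀ v w : Fibre, inner ℂ (X v) w = -inner ℂ v (X w) := by
    intro X hX v w
    have h : ContinuousLinearMap.adjoint X = -X := hX.1
    rw [← ContinuousLinearMap.adjoint_inner_right, h]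
    simp
  have hd : ∀ u, HasDerivAt (fun t => inner ℂ (r t) (s t)) 0 u := by
    intro u
    have hx := geodesic_mem hab u
    have h := (hr u).inner ℂ (hs u)
    have e : inner ℂ (r u) (-(M.A (geodesic a b u) (deriv (geodesic a b) u) (s u))
        + Complex.I • M.Φ (geodesic a b u) (s u)) +
        inner ℂ (-(M.A (geodesic a b u) (deriv (geodesic a b) u) (r u))
        - Complex.I • M.Φ (geodesic a b u) (r u)) (s u) = 0 := by
      rw [inner_add_right, inner_sub_left, inner_neg_left, inner_neg_right, inner_smul_left,
        inner_smul_right, skew _ (M.A_mem _ hx _), skew _ (M.Φ_mem _ hx), Complex.conj_I]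
      ring
    rwa [e] at h
  exact is_const_of_deriv_eq_zero (fun u => (hd u).differentiableAt) (fun u => (hd u).deriv) t 0

end

/-!
The Bogomolny equation and the Bianchi identity give a Weitzenböck formula: the hyperbolic
Laplacian of `‖Φ‖²` is a positive multiple of `‖d_A Φ‖²`. As `‖Φ‖` tends to the mass `m` at
infinity, the strong maximum principle yields either `‖Φ‖ < m` everywhere or `‖Φ‖` constant, in
which case `d_A Φ = 0` and hence `F_A = 0`. The connection does not change lengths, so `‖Φ‖ < m`
makes `e^{mt} ‖s(t)‖` strictly increasing towards its limit `1`; symmetrically for `r`. Hence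
`‖r(0)‖, ‖s(0)‖ < 1`, and the Cauchy–Schwarz inequality bounds each factor of an `n`-point
function. Finally, `⟨P_z P_w⟩` has modulus less than `1` if `z ≠ w` while `⟨P_z P_z⟩ = 1`, so
`P_z ≠ P_w`.
-/

open InnerProductSpace Laplacian RealInnerProductSpace

section SecondDerivativeTest

theorem deriv_deriv_nonpos_of_isLocalMax {g : ℝ → ℝ} {t : ℝ} (hmax : IsLocalMax g t)
    (hcont : ContinuousAt g t) : deriv (deriv g) t ≤ 0 := by
  by_contra! hpos
  have hmin : IsLocalMin g t := isLocalMin_of_deriv_deriv_pos hpos hmax.deriv_eq_zero hcont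
  have hconst : g =ᶠ[𝓝 t] fun _ => g t := by
    filter_upwards [hmax, hmin] with u hle hge using le_antisymm hle hge
  have hzero : deriv (deriv g) t = 0 := by simpa using hconst.deriv.deriv_eq
  exact hpos.ne' hzero

section NormedSpace

variable {E F : Type*} [NormedAddCommGroup E] [NormedSpace ℝ E] [NormedAddCommGroup F]
  [NormedSpace ℝ F] {f : E → F} {x : E}

theorem differentiableAt_fderiv (hf : ContDiffAt ℝ 2 f x) : DifferentiableAt ℝ (fderiv ℝ f) x :=
  (hf.fderiv_right (m := 1) (by norm_num)).differentiableAt (by simp)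

theorem fderiv_fderiv_apply (hf : ContDiffAt ℝ 2 f x) (v w : E) :
    fderiv ℝ (fun y => fderiv ℝ f y w) x v = iteratedFDeriv ℝ 2 f x ![v, w] := by
  rw [iteratedFDeriv_two_apply,
    ((differentiableAt_fderiv hf).hasFDerivAt.clm_apply (hasFDerivAt_const w x)).fderiv]
  simp

theorem deriv_deriv_comp_line (hf : ContDiffAt ℝ 2 f x) (v : E) :
    deriv (deriv fun t : ℝ => f (x + t • v)) 0 = iteratedFDeriv ℝ 2 f x ![v, v] := by
  have hlim : Tendsto (fun t : ℝ => x + t • v) (𝓝 0) (𝓝 x) :=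
    Continuous.tendsto' (by fun_prop) 0 x (by simp)
  have hfirst : (deriv fun t : ℝ => f (x + t • v)) =ᶠ[𝓝 0] fun t => fderiv ℝ f (x + t • v) v := by
    filter_upwards [hlim.eventually (hf.eventually (by simp))] with t ht
    have hline : HasDerivAt (fun t : ℝ => x + t • v) v t := by
      simpa using ((hasDerivAt_id t).smul_const v).const_add x
    exact ((ht.differentiableAt (by simp)).hasFDerivAt.comp_hasDerivAt t hline).deriv
  rw [hfirst.deriv_eq, ← fderiv_fderiv_apply hf]
  exact (((differentiableAt_fderiv hf).clm_apply
    (differentiableAt_const v)).hasFDerivAt.hasLineDerivAt v).deriv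

end NormedSpace

variable {E : Type*} [NormedAddCommGroup E] [InnerProductSpace ℝ E] [FiniteDimensional ℝ E]

theorem laplacian_nonpos_of_isLocalMax {f : E → ℝ} {x : E} (hf : ContDiffAt ℝ 2 f x)
    (hmax : IsLocalMax f x) : Δ f x ≤ 0 := by
  rw [laplacian_eq_iteratedFDeriv_stdOrthonormalBasis]
  refine Finset.sum_nonpos fun i _ => ?_
  rw [← deriv_deriv_comp_line hf]
  set v := stdOrthonormalBasis ℝ E i
  have hline : Continuous fun t : ℝ => x + t • v := by fun_prop
  have hlim : Tendsto (fun t : ℝ => x + t • v) (𝓝 0) (𝓝 x) := hline.tendsto' 0 x (by simp)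
  refine deriv_deriv_nonpos_of_isLocalMax ?_ ?_
  · filter_upwards [hlim.eventually hmax] with t ht
    simpa using ht
  · exact ContinuousAt.comp (by simpa using hf.continuousAt) hline.continuousAt

end SecondDerivativeTest

section Gaussian

variable {E : Type*} [NormedAddCommGroup E] [InnerProductSpace ℝ E]

theorem contDiff_gaussian (α : ℝ) (y : E) {n : WithTop ℕ∞} :
    ContDiff ℝ n fun x => Real.exp (-α * ‖x - y‖ ^ 2) :=
  (contDiff_const.mul ((contDiff_id.sub contDiff_const).norm_sq ℝ)).exp

theorem fderiv_gaussian (α : ℝ) (x y v : E) :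
    fderiv ℝ (fun x => Real.exp (-α * ‖x - y‖ ^ 2)) x v =
      -(2 * α) * ⟪v, x - y⟫ * Real.exp (-α * ‖x - y‖ ^ 2) := by
  have h := (((hasFDerivAt_id x).sub_const y).norm_sq.const_mul (-α)).exp
  simp only [id] at h
  rw [h.fderiv]
  simp only [_root_.smul_apply, ContinuousLinearMap.comp_apply, ContinuousLinearMap.id_apply,
    innerSL_apply_apply, real_inner_comm v, smul_eq_mul, nsmul_eq_mul]
  push_cast
  ring

theorem laplacian_gaussian [FiniteDimensional ℝ E] (α : ℝ) (x y : E) :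
    Δ (fun x => Real.exp (-α * ‖x - y‖ ^ 2)) x =
      (4 * α ^ 2 * ‖x - y‖ ^ 2 - 2 * α * Module.finrank ℝ E) * Real.exp (-α * ‖x - y‖ ^ 2) := by
  have hsecond : ∀ v : E, ‖v‖ = 1 →
      iteratedFDeriv ℝ 2 (fun x => Real.exp (-α * ‖x - y‖ ^ 2)) x ![v, v] =
        (4 * α ^ 2 * ⟪v, x - y⟫ ^ 2 - 2 * α) * Real.exp (-α * ‖x - y‖ ^ 2) := by
    intro v hv
    have hinner : HasFDerivAt (fun x => ⟪v, x - y⟫) (innerSL ℝ v) x := by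
      simpa [inner_sub_right] using ((innerSL ℝ v).hasFDerivAt (x := x)).sub_const ⟪v, y⟫
    have hexp := ((contDiff_gaussian α y).differentiable one_ne_zero x).hasFDerivAt
    rw [← fderiv_fderiv_apply (contDiff_gaussian α y).contDiffAt]
    simp only [fderiv_gaussian]
    rw [((hinner.const_mul (-(2 * α))).fun_mul hexp).fderiv, _root_.add_apply, _root_.smul_apply,
      fderiv_gaussian]
    simp only [_root_.smul_apply, innerSL_apply_apply, real_inner_self_eq_norm_sq, hv, smul_eq_mul]
    ring
  simp only [laplacian_eq_iteratedFDeriv_stdOrthonormalBasis,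
    hsecond _ ((stdOrthonormalBasis ℝ E).norm_eq_one _), ← Finset.sum_mul, Finset.sum_sub_distrib,
    ← Finset.mul_sum, OrthonormalBasis.sum_sq_inner_right]
  simp [mul_comm, mul_left_comm]

end Gaussian

section MaximumPrinciple

variable {E : Type*} [NormedAddCommGroup E] [InnerProductSpace ℝ E] [FiniteDimensional ℝ E]
  {a : E → ℝ} {b : E → E} {f : E → ℝ} {K : ℝ}

theorem not_isLocalMax_of_strict_subsolution {x : E} (ha : 0 ≤ a x) (hf : ContDiffAt ℝ 2 f x)
    (hLf : 0 < a x * Δ f x + fderiv ℝ f x (b x)) : ¬IsLocalMax f x := fun hmax => by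
  rw [hmax.fderiv_eq_zero, _root_.zero_apply, add_zero] at hLf
  exact hLf.not_ge (mul_nonpos_of_nonneg_of_nonpos ha (laplacian_nonpos_of_isLocalMax hf hmax))

theorem exists_gaussian_strict_subsolution {s : Set E} (hs : IsCompact s) (ha : ContinuousOn a s)
    (hb : ContinuousOn b s) (ha_pos : ∀ x ∈ s, 0 < a x) {y : E} (hy : y ∉ s) :
    ∃ α > 0, ∀ x ∈ s, 0 < a x * Δ (fun x => Real.exp (-α * ‖x - y‖ ^ 2)) x +
      fderiv ℝ (fun x => Real.exp (-α * ‖x - y‖ ^ 2)) x (b x) := by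
  have hdist : ∀ x ∈ s, 0 < 2 * a x * ‖x - y‖ ^ 2 := fun x hx => by
    have hxy := norm_pos_iff.2 (sub_ne_zero.2 (ne_of_mem_of_not_mem hx hy))
    have := ha_pos x hx
    positivity
  obtain ⟨C, hC⟩ := hs.bddAbove_image (f := fun x =>
    (Module.finrank ℝ E * a x + ⟪b x, x - y⟫) / (2 * a x * ‖x - y‖ ^ 2))
    (((ha.const_mul _).add (hb.inner (𝕜 := ℝ) (by fun_prop))).div (by fun_prop)
      fun x hx => (hdist x hx).ne')
  have hα : 0 < max C 0 + 1 := by positivity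
  refine ⟨max C 0 + 1, hα, fun x hx => ?_⟩
  set α := max C 0 + 1
  have hlt : (Module.finrank ℝ E * a x + ⟪b x, x - y⟫) / (2 * a x * ‖x - y‖ ^ 2) < α :=
    (hC (mem_image_of_mem _ hx)).trans_lt ((le_max_left C 0).trans_lt (lt_add_one _))
  rw [div_lt_iff₀ (hdist x hx)] at hlt
  rw [laplacian_gaussian, fderiv_gaussian]
  have hpos := mul_pos (mul_pos two_pos hα) (Real.exp_pos (-α * ‖x - y‖ ^ 2))
  linear_combination mul_pos hpos (sub_pos.2 hlt)

theorem le_of_strict_subsolution {s : Set E} (hs : IsCompact s) (ha : ∀ x ∈ interior s, 0 ≤ a x)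
    (hf : ∀ x ∈ s, ContDiffAt ℝ 2 f x)
    (hLf : ∀ x ∈ interior s, 0 < a x * Δ f x + fderiv ℝ f x (b x))
    (hfK : ∀ x ∈ s \ interior s, f x ≤ K) : ∀ x ∈ s, f x ≤ K := by
  intro x hx
  obtain ⟨z, hz, hmax⟩ := hs.exists_isMaxOn ⟨x, hx⟩
    fun x hx => (hf x hx).continuousAt.continuousWithinAt
  have hz_int : z ∉ interior s := fun hint =>
    not_isLocalMax_of_strict_subsolution (ha z hint) (hf z hz) (hLf z hint)
      (hmax.isLocalMax (mem_interior_iff_mem_nhds.1 hint))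
  exact (hmax hx).trans (hfK z ⟨hz, hz_int⟩)

theorem add_smul_le_of_subsolution {g : E → ℝ} {s : Set E} {η : ℝ} (hs : IsCompact s)
    (ha : ∀ x ∈ s, 0 ≤ a x) (hf : ∀ x ∈ s, ContDiffAt ℝ 2 f x) (hg : ∀ x ∈ s, ContDiffAt ℝ 2 g x)
    (hη : 0 < η) (hLf : ∀ x ∈ s, 0 ≤ a x * Δ f x + fderiv ℝ f x (b x))
    (hLg : ∀ x ∈ s, 0 < a x * Δ g x + fderiv ℝ g x (b x))
    (hK : ∀ x ∈ s \ interior s, f x + η * g x ≤ K) : ∀ x ∈ s, f x + η * g x ≤ K := by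
  have hηg : ∀ x ∈ s, ContDiffAt ℝ 2 (η • g) x := fun x hx => contDiffAt_const.smul (hg x hx)
  have hL : ∀ x ∈ s, 0 < a x * Δ (f + η • g) x + fderiv ℝ (f + η • g) x (b x) := fun x hx => by
    rw [(hf x hx).laplacian_add (hηg x hx), laplacian_smul η (hg x hx),
      fderiv_add ((hf x hx).differentiableAt two_ne_zero)
        ((hηg x hx).differentiableAt two_ne_zero),
      fderiv_const_smul ((hg x hx).differentiableAt two_ne_zero)]
    simp only [_root_.add_apply, _root_.smul_apply, smul_eq_mul]
    linear_combination hLf x hx + mul_pos hη (hLg x hx)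
  exact le_of_strict_subsolution hs (fun x hx => ha x (interior_subset hx))
    (fun x hx => (hf x hx).add (hηg x hx)) (fun x hx => hL x (interior_subset hx)) hK

theorem lt_on_annulus_of_le_closedBall {y : E} {R ρ K' : ℝ} (hρ : 0 < ρ)
    (ha : ContinuousOn a (Metric.closedBall y R \ Metric.ball y ρ))
    (hb : ContinuousOn b (Metric.closedBall y R \ Metric.ball y ρ))
    (ha_pos : ∀ x ∈ Metric.closedBall y R \ Metric.ball y ρ, 0 < a x)
    (hf : ∀ x ∈ Metric.closedBall y R \ Metric.ball y ρ, ContDiffAt ℝ 2 f x)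
    (hLf : ∀ x ∈ Metric.closedBall y R \ Metric.ball y ρ, 0 ≤ a x * Δ f x + fderiv ℝ f x (b x))
    (hfK : ∀ x ∈ Metric.closedBall y R, f x ≤ K) (hfρ : ∀ x ∈ Metric.closedBall y ρ, f x ≤ K')
    (hK' : K' < K) : ∀ x ∈ Metric.ball y R \ Metric.ball y ρ, f x < K := by
  rintro x ⟨hxR, hxρ⟩
  have hs_int : Metric.ball y R \ Metric.closedBall y ρ ⊆
      interior (Metric.closedBall y R \ Metric.ball y ρ) :=
    interior_maximal (sdiff_subset_sdiff Metric.ball_subset_closedBall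
      Metric.ball_subset_closedBall) (Metric.isOpen_ball.sdiff Metric.isClosed_closedBall)
  have hs : IsCompact (Metric.closedBall y R \ Metric.ball y ρ) :=
    (isCompact_closedBall y R).diff Metric.isOpen_ball
  -- The barrier `g x = exp (-α ‖x - y‖²)` is a strict subsolution on the annulus, and adding
  -- `(K - K') * g` to `f` does not lift it above `K` on the inner sphere.
  obtain ⟨α, hα, hLg⟩ := exists_gaussian_strict_subsolution hs ha hb ha_pos
    fun hy => hy.2 (Metric.mem_ball_self hρ)
  set g : E → ℝ := fun x => Real.exp (-α * ‖x - y‖ ^ 2)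
  have hη : 0 < K - K' := sub_pos.2 hK'
  have hpos := mul_pos hη (Real.exp_pos (-α * R ^ 2))
  have hh_boundary : ∀ z ∈ (Metric.closedBall y R \ Metric.ball y ρ) \
      interior (Metric.closedBall y R \ Metric.ball y ρ),
      f z + (K - K') * g z ≤ K + (K - K') * Real.exp (-α * R ^ 2) := by
    rintro z ⟨hz, hz_int⟩
    by_cases hzρ : z ∈ Metric.closedBall y ρ
    · have hgz : g z ≤ 1 := Real.exp_le_one_iff.2 (by nlinarith [sq_nonneg ‖z - y‖])
      linear_combination hfρ z hzρ + mul_le_mul_of_nonneg_left hgz hη.le + hpos.le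
    · have hzR : ‖z - y‖ = R := le_antisymm (mem_closedBall_iff_norm.1 hz.1)
        (not_lt.1 fun h => hz_int (hs_int ⟨mem_ball_iff_norm.2 h, hzρ⟩))
      simpa [g, hzR] using hfK z hz.1
  have hh_le := add_smul_le_of_subsolution hs (fun z hz => (ha_pos z hz).le) hf
    (fun z _ => (contDiff_gaussian α y).contDiffAt) hη hLf hLg hh_boundary x
    ⟨Metric.ball_subset_closedBall hxR, hxρ⟩
  have hgx : Real.exp (-α * R ^ 2) < g x := by
    have hxR : ‖x - y‖ < R := mem_ball_iff_norm.1 hxR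
    exact Real.exp_lt_exp.2 (by simp only [neg_mul]; gcongr)
  linarith [mul_lt_mul_of_pos_left hgx hη]

theorem lt_on_ball_of_center_lt {y : E} {R : ℝ} (ha : ContinuousOn a (Metric.closedBall y R))
    (hb : ContinuousOn b (Metric.closedBall y R)) (ha_pos : ∀ x ∈ Metric.closedBall y R, 0 < a x)
    (hf : ∀ x ∈ Metric.closedBall y R, ContDiffAt ℝ 2 f x)
    (hLf : ∀ x ∈ Metric.closedBall y R, 0 ≤ a x * Δ f x + fderiv ℝ f x (b x))
    (hfK : ∀ x ∈ Metric.closedBall y R, f x ≤ K) (hy : f y < K) :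
    ∀ x ∈ Metric.ball y R, f x < K := by
  intro x hx
  obtain ⟨K', hyK', hK'⟩ := exists_between hy
  obtain ⟨ρ, hρ, hfρ⟩ := Metric.nhds_basis_closedBall.eventually_iff.1
    ((hf y (Metric.mem_closedBall_self (Metric.pos_of_mem_ball hx).le)).continuousAt.eventually_lt
      continuousAt_const hyK')
  by_cases hxρ : x ∈ Metric.ball y ρ
  · exact (hfρ (Metric.ball_subset_closedBall hxρ)).trans hK'
  · exact lt_on_annulus_of_le_closedBall hρ (ha.mono sdiff_subset) (hb.mono sdiff_subset)
      (fun z hz => ha_pos z hz.1) (fun z hz => hf z hz.1) (fun z hz => hLf z hz.1) hfK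
      (fun z hz => (hfρ hz).le) hK' x ⟨hx, hxρ⟩

theorem strong_maximum_principle {U : Set E} (hU : IsOpen U) (hconn : IsPreconnected U)
    (ha : ContinuousOn a U) (hb : ContinuousOn b U) (ha_pos : ∀ x ∈ U, 0 < a x)
    (hf : ContDiffOn ℝ 2 f U) (hLf : ∀ x ∈ U, 0 ≤ a x * Δ f x + fderiv ℝ f x (b x))
    (hfK : ∀ x ∈ U, f x ≤ K) {y : E} (hyU : y ∈ U) (hy : f y < K) : ∀ x ∈ U, f x < K := by
  suffices hsub : U ⊆ U ∩ f ⁻¹' Iio K from fun x hx => (hsub hx).2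
  refine hconn.subset_of_closure_inter_subset (hf.continuousOn.isOpen_inter_preimage hU isOpen_Iio)
    ⟨y, hyU, hyU, hy⟩ ?_
  rintro x ⟨hx, hxU⟩
  obtain ⟨r, hr, hball⟩ := Metric.isOpen_iff.1 hU x hxU
  obtain ⟨y, ⟨-, hfy⟩, hxy⟩ := Metric.mem_closure_iff.1 hx (r / 2) (half_pos hr)
  have hsub : Metric.closedBall y (r / 2) ⊆ U :=
    (Metric.closedBall_subset_ball' (by rw [dist_comm]; linarith)).trans hball
  exact ⟨hxU, lt_on_ball_of_center_lt (ha.mono hsub) (hb.mono hsub) (fun z hz => ha_pos z (hsub hz))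
    (fun z hz => hf.contDiffAt (hU.mem_nhds (hsub hz))) (fun z hz => hLf z (hsub hz))
    (fun z hz => hfK z (hsub hz)) hfy x hxy⟩

theorem exists_isMaxOn_ball_of_tendsto {R : ℝ} (hf : ContinuousOn f (Metric.ball 0 R))
    (hlim : Tendsto f (comap norm (𝓝[<] R)) (𝓝 K)) {x₀ : E} (hx₀ : x₀ ∈ Metric.ball 0 R)
    (hfx₀ : K ≤ f x₀) : ∃ x ∈ Metric.ball 0 R, IsMaxOn f (Metric.ball 0 R) x := by
  by_cases hmax : IsMaxOn f (Metric.ball 0 R) x₀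
  · exact ⟨x₀, hx₀, hmax⟩
  obtain ⟨x₁, hx₁, hfx₁⟩ : ∃ x₁ ∈ Metric.ball 0 R, f x₀ < f x₁ := by
    simpa only [isMaxOn_iff, not_forall, not_le, exists_prop] using hmax
  obtain ⟨r, hrR, hr⟩ := (mem_nhdsLT_iff_exists_Ioo_subset (a := R)).1 <| eventually_comap.1 <|
    hlim.eventually_lt_const (hfx₀.trans_lt hfx₁)
  have hnear : ∀ x ∈ Metric.ball (0 : E) R, x ∉ Metric.closedBall 0 r → f x < f x₁ :=
    fun x hxR hxr => hr ⟨by simpa using hxr, mem_ball_zero_iff.1 hxR⟩ x rfl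
  have hsub : Metric.closedBall (0 : E) r ⊆ Metric.ball 0 R := Metric.closedBall_subset_ball hrR
  have hx₁r : x₁ ∈ Metric.closedBall 0 r := by
    by_contra h
    exact (hnear x₁ hx₁ h).false
  obtain ⟨z, hz, hzmax⟩ :=
    (isCompact_closedBall (0 : E) r).exists_isMaxOn ⟨x₁, hx₁r⟩ (hf.mono hsub)
  have hx₁z : f x₁ ≤ f z := hzmax hx₁r
  refine ⟨z, hsub hz, fun x hx => ?_⟩
  by_cases hxr : x ∈ Metric.closedBall 0 r
  · exact hzmax hxr
  · exact (hnear x hx hxr).le.trans hx₁z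

theorem lt_or_eqOn_const_of_tendsto {R : ℝ} (ha : ContinuousOn a (Metric.ball 0 R))
    (hb : ContinuousOn b (Metric.ball 0 R)) (ha_pos : ∀ x ∈ Metric.ball 0 R, 0 < a x)
    (hf : ContDiffOn ℝ 2 f (Metric.ball 0 R))
    (hLf : ∀ x ∈ Metric.ball 0 R, 0 ≤ a x * Δ f x + fderiv ℝ f x (b x))
    (hlim : Tendsto f (comap norm (𝓝[<] R)) (𝓝 K)) :
    (∀ x ∈ Metric.ball 0 R, f x < K) ∨ ∃ c, EqOn f (fun _ => c) (Metric.ball 0 R) := by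
  by_contra! ⟨⟨x₀, hx₀, hfx₀⟩, hconst⟩
  obtain ⟨z, hz, hmax⟩ := exists_isMaxOn_ball_of_tendsto hf.continuousOn hlim hx₀ hfx₀
  refine hconst (f z) fun x hx => (hmax hx).antisymm (not_lt.1 fun hlt => ?_)
  exact (strong_maximum_principle Metric.isOpen_ball (convex_ball 0 R).isPreconnected ha hb ha_pos
    hf hLf hmax hx hlt z hz).false

end MaximumPrinciple

section SpecialUnitary

theorem mul_self_eq_of_finrank_eq_two {𝕜 V : Type*} [Field 𝕜] [AddCommGroup V] [Module 𝕜 V]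
    (hV : Module.finrank 𝕜 V = 2) (f : Module.End 𝕜 V) :
    f * f = LinearMap.trace 𝕜 V f • f - LinearMap.det f • 1 := by
  have := Module.finite_of_finrank_eq_succ hV
  let e := Module.finBasisOfFinrankEq 𝕜 V hV
  have hCH := f.aeval_self_charpoly
  rw [← LinearMap.charpoly_toMatrix f e, Matrix.charpoly_fin_two,
    ← LinearMap.trace_eq_matrix_trace 𝕜 e, LinearMap.det_toMatrix] at hCH
  simp only [map_add, map_sub, map_mul, Polynomial.aeval_X, Polynomial.aeval_C,
    Algebra.algebraMap_eq_smul_one, smul_mul_assoc, one_mul, sq] at hCH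
  rw [← sub_eq_zero, ← hCH]
  abel

theorem eq_norm_sq_of_star_mul_self_eq_smul_one {V : Type*} [NormedAddCommGroup V]
    [InnerProductSpace ℂ V] [CompleteSpace V] [Nontrivial V] {T : V →L[ℂ] V} {d : ℂ}
    (hT : star T * T = d • 1) : d = (‖T‖ ^ 2 : ℝ) := by
  obtain ⟨v, hv⟩ := exists_norm_eq V zero_le_one
  have hd : d = (‖T v‖ ^ 2 : ℝ) := by
    have h : inner ℂ v ((star T * T) v) = inner ℂ v ((d • 1 : V →L[ℂ] V) v) := by rw [hT]
    simpa [ContinuousLinearMap.star_eq_adjoint, ContinuousLinearMap.adjoint_inner_right,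
      inner_smul_right, inner_self_eq_norm_sq_to_K, hv] using h.symm
  have hnorm : ‖T‖ ^ 2 = ‖d‖ := by
    rw [sq, ← CStarRing.norm_star_mul_self, hT, norm_smul, norm_one, mul_one]
  rw [hnorm, hd, Complex.norm_real, Real.norm_of_nonneg (by positivity)]

/-- The invariant form `-Re tr(XY) / 2` on endomorphisms of the fibre, normalised so that its
quadratic form restricts to the squared operator norm on `su(2)`. -/
noncomputable def traceForm : EndF →L[ℝ] EndF →L[ℝ] ℝ :=
  LinearMap.toContinuousBilinearMap <| (LinearMap.mul ℝ EndF).compr₂ <|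
    (-(1 / 2) : ℝ) • Complex.reLm ∘ₗ ((LinearMap.trace ℂ Fibre) ∘ₗ
      (ContinuousLinearMap.coeLM ℂ : EndF →ₗ[ℂ] (Fibre →ₗ[ℂ] Fibre))).restrictScalars ℝ

theorem traceForm_apply (X Y : EndF) :
    traceForm X Y = -(1 / 2) * (LinearMap.trace ℂ Fibre (X * Y : EndF)).re := rfl

theorem traceForm_comm (X Y : EndF) : traceForm X Y = traceForm Y X := by
  rw [traceForm_apply, traceForm_apply]
  congr 2
  exact LinearMap.trace_mul_comm ℂ (X : Fibre →ₗ[ℂ] Fibre) Y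

theorem traceForm_mul_left (X Y Z : EndF) : traceForm (X * Y) Z = traceForm X (Y * Z) := by
  rw [traceForm_apply, traceForm_apply, mul_assoc]

theorem traceForm_commutator_add (T X Y : EndF) :
    traceForm (T * X - X * T) Y + traceForm X (T * Y - Y * T) = 0 := by
  rw [map_sub, map_sub, _root_.sub_apply, traceForm_mul_left T, traceForm_comm T,
    traceForm_mul_left, traceForm_mul_left]
  ring

theorem inner_apply_left_of_mem_su2 {X : EndF} (hX : X ∈ su2) (v w : Fibre) :
    inner ℂ (X v) w = -inner ℂ v (X w) := by
  have hadj : ContinuousLinearMap.adjoint X = -X := hX.1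
  rw [← ContinuousLinearMap.adjoint_inner_right, hadj, _root_.neg_apply, inner_neg_right]

theorem mem_su2_iff {X : EndF} : X ∈ su2 ↔ (∀ v w, inner ℂ (X v) w = -inner ℂ v (X w)) ∧
    LinearMap.trace ℂ Fibre (X : Fibre →ₗ[ℂ] Fibre) = 0 := by
  refine ⟨fun hX => ⟨inner_apply_left_of_mem_su2 hX, hX.2⟩, fun ⟨hX, htr⟩ => ⟨?_, htr⟩⟩
  refine ((ContinuousLinearMap.eq_adjoint_iff (-X) X).2 fun v w => ?_).symm
  rw [_root_.neg_apply, inner_neg_left, hX, neg_neg]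

theorem re_inner_apply_self_of_mem_su2 {X : EndF} (hX : X ∈ su2) (v : Fibre) :
    (inner ℂ v (X v)).re = 0 := by
  have h := congrArg Complex.re (inner_apply_left_of_mem_su2 hX v v)
  rw [← inner_conj_symm, Complex.conj_re, Complex.neg_re] at h
  linarith

theorem traceForm_self {X : EndF} (hX : X ∈ su2) : traceForm X X = ‖X‖ ^ 2 := by
  set d := LinearMap.det (X : Fibre →ₗ[ℂ] Fibre)
  have hsq : X * X = -d • (1 : EndF) := by
    have hCH := mul_self_eq_of_finrank_eq_two (by simp) (X : Fibre →ₗ[ℂ] Fibre)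
    rw [hX.2, zero_smul, zero_sub, ← neg_smul] at hCH
    exact ContinuousLinearMap.coe_injective hCH
  have hd : d = (‖X‖ ^ 2 : ℝ) := by
    refine eq_norm_sq_of_star_mul_self_eq_smul_one ?_
    rw [hX.1, neg_mul, hsq]
    module
  have htr : LinearMap.trace ℂ Fibre (X * X : EndF) = -d * 2 := by
    rw [hsq, ContinuousLinearMap.toLinearMap_smul, map_smul, ContinuousLinearMap.toLinearMap_one,
      LinearMap.trace_one]
    simp
  rw [traceForm_apply, htr, hd, ← Complex.ofReal_neg, Complex.re_ofReal_mul, Complex.re_ofNat]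
  ring

/-- `su2` as a real vector space. -/
noncomputable def su2Submodule : Submodule ℝ EndF where
  carrier := su2
  zero_mem' := mem_su2_iff.2 (by simp)
  add_mem' {X Y} hX hY := by
    rw [mem_su2_iff] at hX hY ⊢
    simp [hX, hY, add_comm]
  smul_mem' c X hX := by
    rw [mem_su2_iff] at hX ⊢
    simp [hX]

theorem commutator_mem_su2 {X Y : EndF} (hX : X ∈ su2) (hY : Y ∈ su2) : X * Y - Y * X ∈ su2 := by
  refine mem_su2_iff.2 ⟨fun v w => ?_, ?_⟩
  · simp [inner_apply_left_of_mem_su2 hX, inner_apply_left_of_mem_su2 hY]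
  · simp [LinearMap.trace_mul_comm]

theorem fderiv_apply_mem_of_eventually_mem {E F : Type*} [NormedAddCommGroup E] [NormedSpace ℝ E]
    [NormedAddCommGroup F] [NormedSpace ℝ F] {S : Submodule ℝ F} (hS : IsClosed (S : Set F))
    {f : E → F} {x : E} (hf : ∀ᶠ y in 𝓝 x, f y ∈ S) (v : E) : fderiv ℝ f x v ∈ S := by
  by_cases hd : DifferentiableAt ℝ f x
  · have hline := hd.hasFDerivAt.hasLineDerivAt v
    have hlim : Tendsto (fun t : ℝ => x + t • v) (𝓝 0) (𝓝 x) :=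
      Continuous.tendsto' (by fun_prop) 0 x (by simp)
    refine hS.mem_of_tendsto (hasDerivAt_iff_tendsto_slope.1 hline) ?_
    filter_upwards [(hlim.eventually hf).filter_mono nhdsWithin_le_nhds] with t ht
    exact S.smul_mem _ (S.sub_mem ht (by simpa using hf.self_of_nhds))
  · simp [fderiv_zero_of_not_differentiableAt hd]

theorem covDeriv_mem_su2 {A : E3 → E3 →L[ℝ] EndF} {Φ : E3 → EndF} {x u : E3}
    (hA : A x u ∈ su2) (hΦ : ∀ᶠ y in 𝓝 x, Φ y ∈ su2) : covDeriv A Φ x u ∈ su2 :=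
  su2Submodule.add_mem
    (fderiv_apply_mem_of_eventually_mem su2Submodule.closed_of_finiteDimensional hΦ u)
    (commutator_mem_su2 hA hΦ.self_of_nhds)

end SpecialUnitary

section ClmValued

variable {E F G : Type*} [NormedAddCommGroup E] [NormedSpace ℝ E] [NormedAddCommGroup F]
  [NormedSpace ℝ F] [NormedAddCommGroup G] [NormedSpace ℝ G] {f : E → F →L[ℝ] G} {x : E}

theorem differentiableAt_fderiv_apply_apply (hf : ContDiffAt ℝ 2 f x) (v : E) (w : F) :
    DifferentiableAt ℝ (fun y => fderiv ℝ f y v w) x :=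
  ((differentiableAt_fderiv hf).clm_apply (differentiableAt_const v)).clm_apply
    (differentiableAt_const w)

theorem fderiv_fderiv_apply_apply_comm (hf : ContDiffAt ℝ 2 f x) (u v : E) (w : F) :
    fderiv ℝ (fun y => fderiv ℝ f y v w) x u = fderiv ℝ (fun y => fderiv ℝ f y u w) x v := by
  have happly (u v : E) : fderiv ℝ (fun y => fderiv ℝ f y v w) x u =
      fderiv ℝ (fderiv ℝ f) x u v w := by
    rw [(((differentiableAt_fderiv hf).hasFDerivAt.clm_apply (hasFDerivAt_const v x)).clm_apply
      (hasFDerivAt_const w x)).fderiv]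
    simp
  rw [happly, happly, (hf.isSymmSndFDerivAt (by simp)).eq]

end ClmValued

theorem contDiffAt_of_bilinear {E F G H : Type*} [NormedAddCommGroup E] [NormedSpace ℝ E]
    [NormedAddCommGroup F] [NormedSpace ℝ F] [NormedAddCommGroup G] [NormedSpace ℝ G]
    [NormedAddCommGroup H] [NormedSpace ℝ H] (B : F →L[ℝ] G →L[ℝ] H) {n : WithTop ℕ∞}
    {f : E → F} {g : E → G} {x : E} (hf : ContDiffAt ℝ n f x) (hg : ContDiffAt ℝ n g x) :
    ContDiffAt ℝ n (fun y => B (f y) (g y)) x :=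
  B.isBoundedBilinearMap.contDiff.contDiffAt.comp x (hf.prodMk hg)

theorem eq_zero_of_isAlt_of_basis_fin_three {R M N : Type*} [CommRing R] [AddCommGroup M]
    [Module R M] [AddCommGroup N] [Module R N] {B : M →ₗ[R] M →ₗ[R] N} (hB : B.IsAlt)
    (b : Module.Basis (Fin 3) R M) (h : ∀ i, B (b (i + 1)) (b (i + 2)) = 0) : B = 0 := by
  refine LinearMap.ext_basis b b fun i j => ?_
  obtain rfl | ⟨k, ⟨rfl, rfl⟩ | ⟨rfl, rfl⟩⟩ :
      i = j ∨ ∃ k, (i = k + 1 ∧ j = k + 2) ∨ (i = k + 2 ∧ j = k + 1) := by decide +revert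
  · exact hB _
  · exact h k
  · rw [← hB.neg, h, neg_zero, LinearMap.zero_apply, LinearMap.zero_apply]

section GaugeTheory

variable {A : E3 → E3 →L[ℝ] EndF} {Φ Ψ : E3 → EndF} {x : E3}

theorem covDeriv_congr (h : Φ =ᶠ[𝓝 x] Ψ) (u : E3) : covDeriv A Φ x u = covDeriv A Ψ x u := by
  rw [covDeriv, covDeriv, h.fderiv_eq, h.self_of_nhds]

theorem covDeriv_smul {p : E3 → ℝ} (hp : DifferentiableAt ℝ p x) (hΦ : DifferentiableAt ℝ Φ x)
    (u : E3) : covDeriv A (fun y => p y • Φ y) x u =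
      fderiv ℝ p x u • Φ x + p x • covDeriv A Φ x u := by
  rw [covDeriv, covDeriv, fderiv_fun_smul hp hΦ, Algebra.mul_smul_comm (p x) (A x u) (Φ x),
    Algebra.smul_mul_assoc (p x) (Φ x), _root_.add_apply, _root_.smul_apply,
    ContinuousLinearMap.smulRight_apply]
  module

theorem differentiableAt_covDeriv (hA : DifferentiableAt ℝ A x) (hΦ : ContDiffAt ℝ 2 Φ x)
    (u : E3) : DifferentiableAt ℝ (fun y => covDeriv A Φ y u) x := by
  have h := differentiableAt_fderiv hΦ
  have h' := hΦ.differentiableAt two_ne_zero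
  unfold covDeriv
  fun_prop

theorem fderiv_traceForm (hΦ : DifferentiableAt ℝ Φ x) (hΨ : DifferentiableAt ℝ Ψ x) (u : E3) :
    fderiv ℝ (fun y => traceForm (Φ y) (Ψ y)) x u =
      traceForm (covDeriv A Φ x u) (Ψ x) + traceForm (Φ x) (covDeriv A Ψ x u) := by
  have hd : HasFDerivAt (fun y => traceForm (Φ y) (Ψ y)) _ x :=
    traceForm.hasFDerivAt_of_bilinear hΦ.hasFDerivAt hΨ.hasFDerivAt
  have hT := traceForm_commutator_add (A x u) (Φ x) (Ψ x)
  rw [hd.fderiv, covDeriv, covDeriv, map_add, map_add, _root_.add_apply, _root_.add_apply]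
  change traceForm (Φ x) (fderiv ℝ Ψ x u) + traceForm (fderiv ℝ Φ x u) (Ψ x) = _
  linear_combination -hT

theorem fderiv_curvature (hA : ContDiffAt ℝ 2 A x) (u v w : E3) :
    fderiv ℝ (fun y => curvature A y v w) x u =
      fderiv ℝ (fun y => fderiv ℝ A y v w) x u - fderiv ℝ (fun y => fderiv ℝ A y w v) x u +
        ((A x v * fderiv ℝ A x u w + fderiv ℝ A x u v * A x w) -
          (A x w * fderiv ℝ A x u v + fderiv ℝ A x u w * A x v)) := by
  have hA' (v : E3) : HasFDerivAt (fun y => A y v) _ x :=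
    (hA.differentiableAt two_ne_zero).hasFDerivAt.clm_apply (hasFDerivAt_const v x)
  have hA'' (v w : E3) := (differentiableAt_fderiv_apply_apply hA v w).hasFDerivAt
  have h : HasFDerivAt (fun y => curvature A y v w) _ x := ((hA'' v w).sub (hA'' w v)).add
    (((hA' v).mul' (hA' w)).sub ((hA' w).mul' (hA' v)))
  rw [h.fderiv]
  simp

theorem differentiableAt_curvature (hA : ContDiffAt ℝ 2 A x) (v w : E3) :
    DifferentiableAt ℝ (fun y => curvature A y v w) x := by
  have h := differentiableAt_fderiv hA
  have h' := hA.differentiableAt two_ne_zero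
  unfold curvature
  fun_prop

theorem curvature_add_left (u u' v : E3) :
    curvature A x (u + u') v = curvature A x u v + curvature A x u' v := by
  simp only [curvature, map_add, _root_.add_apply, add_mul, mul_add]
  abel

theorem curvature_smul_left (c : ℝ) (u v : E3) :
    curvature A x (c • u) v = c • curvature A x u v := by
  simp only [curvature, map_smul, _root_.smul_apply]
  rw [Algebra.mul_smul_comm c (A x v) (A x u), Algebra.smul_mul_assoc c (A x u) (A x v)]
  module

theorem curvature_swap (u v : E3) : curvature A x u v = -curvature A x v u := by
  simp only [curvature]
  abel

theorem curvature_eq_zero_of_stdVec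
    (h : ∀ i, curvature A x (stdVec (i + 1)) (stdVec (i + 2)) = 0) (u v : E3) :
    curvature A x u v = 0 := by
  let F : E3 →ₗ[ℝ] E3 →ₗ[ℝ] EndF := LinearMap.mk₂ ℝ (curvature A x) curvature_add_left
    curvature_smul_left
    (fun u v v' => by
      rw [curvature_swap, curvature_add_left, neg_add, ← curvature_swap, ← curvature_swap])
    (fun c u v => by
      rw [curvature_swap, curvature_smul_left, curvature_swap u, smul_neg])
  have hF : F.IsAlt := fun u => by simp [F, curvature]
  refine LinearMap.congr_fun₂ (eq_zero_of_isAlt_of_basis_fin_three hF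
    (EuclideanSpace.basisFun (Fin 3) ℝ).toBasis fun i => ?_) u v
  simpa [F, stdVec] using h i

theorem bianchi_identity (hA : ContDiffAt ℝ 2 A x) (u v w : E3) :
    covDeriv A (fun y => curvature A y v w) x u + covDeriv A (fun y => curvature A y w u) x v +
      covDeriv A (fun y => curvature A y u v) x w = 0 := by
  simp only [covDeriv, fderiv_curvature hA]
  simp only [curvature]
  rw [fderiv_fderiv_apply_apply_comm hA v u, fderiv_fderiv_apply_apply_comm hA w u,
    fderiv_fderiv_apply_apply_comm hA w v]
  simp only [mul_add, mul_sub, add_mul, sub_mul, mul_assoc]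
  abel

theorem hasFDerivAt_invConformalFactor (x : E3) :
    HasFDerivAt invConformalFactor (-innerSL ℝ x) x := by
  have h : HasFDerivAt invConformalFactor _ x :=
    (((hasStrictFDerivAt_norm_sq x).hasFDerivAt).const_sub 1).mul_const (2⁻¹ : ℝ)
  exact h.congr_fderiv (by ext; simp)

theorem laplacian_traceForm_self (hA : DifferentiableAt ℝ A x) (hΦ : ContDiffAt ℝ 2 Φ x) :
    Δ (fun y => traceForm (Φ y) (Φ y)) x =
      2 * ∑ i, (traceForm (covDeriv A (fun y => covDeriv A Φ y (stdVec i)) x (stdVec i)) (Φ x) +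
        traceForm (covDeriv A Φ x (stdVec i)) (covDeriv A Φ x (stdVec i))) := by
  have hΦ' : ∀ᶠ y in 𝓝 x, DifferentiableAt ℝ Φ y :=
    (hΦ.eventually (by simp)).mono fun y hy => hy.differentiableAt two_ne_zero
  rw [laplacian_eq_iteratedFDeriv_orthonormalBasis _ (EuclideanSpace.basisFun (Fin 3) ℝ),
    Finset.mul_sum]
  refine Finset.sum_congr rfl fun i _ => ?_
  have hfirst : (fun y => fderiv ℝ (fun y => traceForm (Φ y) (Φ y)) y (stdVec i)) =ᶠ[𝓝 x]
      fun y => 2 * traceForm (covDeriv A Φ y (stdVec i)) (Φ y) := by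
    filter_upwards [hΦ'] with y hy
    rw [fderiv_traceForm hy hy, traceForm_comm (Φ y)]
    ring
  rw [← fderiv_fderiv_apply (contDiffAt_of_bilinear traceForm hΦ hΦ), EuclideanSpace.basisFun_apply]
  have hd := differentiableAt_covDeriv hA hΦ (stdVec i)
  have hd' : DifferentiableAt ℝ (fun y => traceForm (covDeriv A Φ y (stdVec i)) (Φ y)) x :=
    (traceForm.hasFDerivAt_of_bilinear hd.hasFDerivAt hΦ'.self_of_nhds.hasFDerivAt).differentiableAt
  rw [show EuclideanSpace.single i 1 = stdVec i from rfl, hfirst.fderiv_eq,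
    fderiv_const_mul hd', _root_.smul_apply, fderiv_traceForm hd hΦ'.self_of_nhds, smul_eq_mul]

theorem sum_covDeriv_covDeriv_of_bogomolny (hA : ContDiffAt ℝ 2 A x)
    (hB : ∀ᶠ y in 𝓝 x, ∀ i, covDeriv A Φ y (stdVec i) =
      invConformalFactor y • curvature A y (stdVec (i + 1)) (stdVec (i + 2))) :
    invConformalFactor x •
        ∑ i, covDeriv A (fun y => covDeriv A Φ y (stdVec i)) x (stdVec i) +
      ∑ i, x i • covDeriv A Φ x (stdVec i) = 0 := by
  have hp := hasFDerivAt_invConformalFactor x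
  have hD (i : Fin 3) : covDeriv A (fun y => covDeriv A Φ y (stdVec i)) x (stdVec i) =
      -x i • curvature A x (stdVec (i + 1)) (stdVec (i + 2)) + invConformalFactor x •
        covDeriv A (fun y => curvature A y (stdVec (i + 1)) (stdVec (i + 2))) x (stdVec i) := by
    rw [covDeriv_congr (hB.mono fun y hy => hy i),
      covDeriv_smul hp.differentiableAt (differentiableAt_curvature hA _ _), hp.fderiv, stdVec,
      _root_.neg_apply, innerSL_apply_apply, EuclideanSpace.inner_single_right]
    simp
  have hbianchi : ∑ i : Fin 3, covDeriv A
      (fun y => curvature A y (stdVec (i + 1)) (stdVec (i + 2))) x (stdVec i) = 0 := by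
    rw [Fin.sum_univ_three]
    exact bianchi_identity hA (stdVec 0) (stdVec 1) (stdVec 2)
  simp only [hD, hB.self_of_nhds, Finset.sum_add_distrib, ← Finset.smul_sum, hbianchi]
  rw [smul_zero, add_zero, Finset.smul_sum, ← Finset.sum_add_distrib]
  exact Finset.sum_eq_zero fun i _ => by module

theorem weitzenbock_of_bogomolny (hA : ContDiffAt ℝ 2 A x) (hΦ : ContDiffAt ℝ 2 Φ x)
    (hB : ∀ᶠ y in 𝓝 x, ∀ i, covDeriv A Φ y (stdVec i) =
      invConformalFactor y • curvature A y (stdVec (i + 1)) (stdVec (i + 2))) :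
    invConformalFactor x * Δ (fun y => traceForm (Φ y) (Φ y)) x +
        fderiv ℝ (fun y => traceForm (Φ y) (Φ y)) x x =
      2 * invConformalFactor x *
        ∑ i, traceForm (covDeriv A Φ x (stdVec i)) (covDeriv A Φ x (stdVec i)) := by
  have hΦ' := hΦ.differentiableAt two_ne_zero
  have hradial : fderiv ℝ (fun y => traceForm (Φ y) (Φ y)) x x =
      2 * ∑ i, x i * traceForm (covDeriv A Φ x (stdVec i)) (Φ x) := by
    have hx : ∑ i, x i • stdVec i = x := by
      simpa [stdVec] using (EuclideanSpace.basisFun (Fin 3) ℝ).sum_repr x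
    nth_rw 2 [← hx]
    rw [map_sum, Finset.mul_sum]
    refine Finset.sum_congr rfl fun i _ => ?_
    rw [map_smul, fderiv_traceForm hΦ' hΦ' (A := A), traceForm_comm (Φ x), smul_eq_mul]
    ring
  have h := congrArg (fun X => traceForm X (Φ x)) (sum_covDeriv_covDeriv_of_bogomolny hA hB)
  simp only [map_add, map_smul, map_sum, _root_.add_apply, _root_.smul_apply, _root_.zero_apply,
    smul_eq_mul, map_zero, _root_.sum_apply] at h
  rw [laplacian_traceForm_self (hA.differentiableAt two_ne_zero) hΦ, hradial,
    Finset.sum_add_distrib]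
  linear_combination 2 * h

end GaugeTheory

theorem isOpen_hyperbolicBall : IsOpen hyperbolicBall := Metric.isOpen_ball

theorem invConformalFactor_pos {x : E3} (hx : x ∈ hyperbolicBall) : 0 < invConformalFactor x := by
  have hx' : ‖x‖ < 1 := mem_ball_zero_iff.1 hx
  have hsq : ‖x‖ ^ 2 < 1 := pow_lt_one₀ (norm_nonneg x) hx' two_ne_zero
  rw [invConformalFactor]
  linarith

namespace HyperbolicMonopole

variable {M : HyperbolicMonopole}

theorem contDiffAt_A (M : HyperbolicMonopole) {x : E3} (hx : x ∈ hyperbolicBall) :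
    ContDiffAt ℝ 2 M.A x :=
  contDiffAt_infty.1 (M.smooth_A.contDiffAt (isOpen_hyperbolicBall.mem_nhds hx)) 2

theorem contDiffAt_Φ (M : HyperbolicMonopole) {x : E3} (hx : x ∈ hyperbolicBall) :
    ContDiffAt ℝ 2 M.Φ x :=
  contDiffAt_infty.1 (M.smooth_Φ.contDiffAt (isOpen_hyperbolicBall.mem_nhds hx)) 2

theorem weitzenbock (M : HyperbolicMonopole) {x : E3} (hx : x ∈ hyperbolicBall) :
    invConformalFactor x * Δ (fun y => traceForm (M.Φ y) (M.Φ y)) x +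
        fderiv ℝ (fun y => traceForm (M.Φ y) (M.Φ y)) x x =
      2 * invConformalFactor x * ∑ i, ‖covDeriv M.A M.Φ x (stdVec i)‖ ^ 2 := by
  have hball := isOpen_hyperbolicBall.eventually_mem hx
  rw [weitzenbock_of_bogomolny (M.contDiffAt_A hx) (M.contDiffAt_Φ hx)
    (hball.mono fun y hy => M.bogomolny y hy)]
  congr 1
  exact Finset.sum_congr rfl fun i _ => traceForm_self <|
    covDeriv_mem_su2 (M.A_mem x hx _) (hball.mono fun y hy => M.Φ_mem y hy)

theorem curvature_eq_zero_of_eqOn_const (M : HyperbolicMonopole) {c : ℝ}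
    (hc : EqOn (fun y => traceForm (M.Φ y) (M.Φ y)) (fun _ => c) hyperbolicBall) {x : E3}
    (hx : x ∈ hyperbolicBall) (u v : E3) : curvature M.A x u v = 0 := by
  have hconst : (fun y => traceForm (M.Φ y) (M.Φ y)) =ᶠ[𝓝 x] fun _ => c :=
    hc.eventuallyEq_of_mem (isOpen_hyperbolicBall.mem_nhds hx)
  have hp := invConformalFactor_pos hx
  have hsum : ∑ i, ‖covDeriv M.A M.Φ x (stdVec i)‖ ^ 2 = 0 := by
    have h := M.weitzenbock hx
    rw [(laplacian_congr_nhds hconst).self_of_nhds, hconst.fderiv_eq] at h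
    simpa [hp.ne', eq_comm] using h
  rw [Finset.sum_eq_zero_iff_of_nonneg fun i _ => by positivity] at hsum
  refine curvature_eq_zero_of_stdVec (fun i => ?_) u v
  have hi : covDeriv M.A M.Φ x (stdVec i) = 0 := by simpa using hsum i (Finset.mem_univ i)
  rw [M.bogomolny x hx] at hi
  exact (smul_eq_zero.1 hi).resolve_left hp.ne'

theorem Nontrivial.norm_Φ_lt_mass (hM : M.Nontrivial) {x : E3} (hx : x ∈ hyperbolicBall) :
    ‖M.Φ x‖ < M.mass := by
  have hnormSq : ∀ y ∈ hyperbolicBall, traceForm (M.Φ y) (M.Φ y) = ‖M.Φ y‖ ^ 2 :=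
    fun y hy => traceForm_self (M.Φ_mem y hy)
  have hlim : Tendsto (fun y => traceForm (M.Φ y) (M.Φ y)) (comap norm (𝓝[<] 1))
      (𝓝 (M.mass ^ 2)) := by
    refine (M.tendsto_norm_Φ.pow 2).congr' ?_
    filter_upwards [preimage_mem_comap self_mem_nhdsWithin] with y hy
    exact (hnormSq y (mem_ball_zero_iff.2 hy)).symm
  rcases lt_or_eqOn_const_of_tendsto (a := invConformalFactor) (b := id)
    (fun y _ => (hasFDerivAt_invConformalFactor y).continuousAt.continuousWithinAt)
    continuousOn_id (fun y hy => invConformalFactor_pos hy)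
    (fun y hy => (contDiffAt_of_bilinear traceForm (M.contDiffAt_Φ hy)
      (M.contDiffAt_Φ hy)).contDiffWithinAt)
    (fun y hy => by
      have hp := invConformalFactor_pos hy
      rw [id, M.weitzenbock hy]
      positivity) hlim with hlt | ⟨c, hc⟩
  · exact lt_of_pow_lt_pow_left₀ 2 M.mass_pos.le (hnormSq x hx ▸ hlt x hx)
  · obtain ⟨y, hy, u, v, hF⟩ := hM
    exact absurd (M.curvature_eq_zero_of_eqOn_const hc hy u v) hF

end HyperbolicMonopole

theorem hasDerivAt_sq_exp_mul_norm (𝕜 : Type*) {V : Type*} [RCLike 𝕜] [NormedAddCommGroup V]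
    [InnerProductSpace 𝕜 V] [NormedSpace ℝ V] {s : ℝ → V} {s' : V} {t : ℝ}
    (hs : HasDerivAt s s' t) (m : ℝ) :
    HasDerivAt (fun t => (Real.exp (m * t) * ‖s t‖) ^ 2)
      (2 * Real.exp (m * t) ^ 2 * (m * ‖s t‖ ^ 2 + RCLike.re (inner 𝕜 (s t) s'))) t := by
  have hnorm : HasDerivAt (fun t => ‖s t‖ ^ 2) (2 * RCLike.re (inner 𝕜 (s t) s')) t := by
    have h := RCLike.reCLM.hasFDerivAt.comp_hasDerivAt t (hs.inner 𝕜 hs)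
    refine (h.congr_deriv ?_).congr_of_eventuallyEq (Eventually.of_forall fun u => ?_)
    · simp only [map_add, RCLike.reCLM_apply, inner_re_symm s' (s t)]
      ring
    · simp
  have hexp : HasDerivAt (fun t => Real.exp (m * t)) (Real.exp (m * t) * (m * 1)) t :=
    ((hasDerivAt_id t).const_mul m).exp
  simp only [mul_pow]
  refine ((hexp.fun_pow 2).fun_mul hnorm).congr_deriv ?_
  simp only [Nat.cast_ofNat, Nat.add_one_sub_one, pow_one]
  ring

theorem exp_mul_norm_lt_of_tendsto {𝕜 V : Type*} [RCLike 𝕜] [NormedAddCommGroup V]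
    [InnerProductSpace 𝕜 V] [NormedSpace ℝ V] {s s' : ℝ → V} {m L : ℝ}
    (hs : ∀ t, HasDerivAt s (s' t) t)
    (hm : ∀ t, s t ≠ 0 → 0 < m * ‖s t‖ ^ 2 + RCLike.re (inner 𝕜 (s t) (s' t)))
    (hlim : Tendsto (fun t => Real.exp (m * t) * ‖s t‖) atTop (𝓝 L)) (hL : 0 < L) (t : ℝ) :
    Real.exp (m * t) * ‖s t‖ < L := by
  have hderiv := fun t => hasDerivAt_sq_exp_mul_norm 𝕜 (hs t) m
  have hmono : Monotone fun t => (Real.exp (m * t) * ‖s t‖) ^ 2 := by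
    refine monotone_of_hasDerivAt_nonneg hderiv fun t => ?_
    by_cases h0 : s t = 0
    · simp [h0]
    · have := hm t h0
      positivity
  have hle : ∀ t, (Real.exp (m * t) * ‖s t‖) ^ 2 ≤ L ^ 2 := hmono.ge_of_tendsto (hlim.pow 2)
  refine (le_of_pow_le_pow_left₀ two_ne_zero hL.le (hle t)).lt_of_ne fun heq => ?_
  have h0 : s t ≠ 0 := fun h0 => hL.ne (by simpa [h0] using heq)
  have hmax : IsLocalMax (fun t => (Real.exp (m * t) * ‖s t‖) ^ 2) t :=
    Eventually.of_forall fun u => (hle u).trans_eq (congrArg (· ^ 2) heq.symm)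
  have hpos := hm t h0
  exact absurd (hmax.hasDerivAt_eq_zero (hderiv t)) (by positivity)

theorem geodesic_neg (a b : Boundary) (t : ℝ) : geodesic a b (-t) = geodesic b a t := by
  rw [geodesic, geodesic, neg_neg, norm_sub_rev (b : E3), add_comm (Real.exp (-t)),
    add_comm (Real.exp (-t) • (b : E3))]

namespace HyperbolicMonopole

variable {M : HyperbolicMonopole}

theorem IsDecayingS.norm_lt_one (hM : M.Nontrivial) {a b : Boundary} (hab : a ≠ b)
    {s : ℝ → Fibre} (hs : M.IsDecayingS a b s) : ‖s 0‖ < 1 := by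
  suffices h : Real.exp (M.mass * 0) * ‖s 0‖ < 1 by simpa using h
  refine exp_mul_norm_lt_of_tendsto (𝕜 := ℂ) hs.1 (fun t hst => ?_) hs.2 one_pos 0
  have hx := geodesic_mem hab t
  have hA := re_inner_apply_self_of_mem_su2 (M.A_mem _ hx (deriv (geodesic a b) t)) (s t)
  set ΦS := M.Φ (geodesic a b t) (s t)
  have hΦ : ‖ΦS‖ < M.mass * ‖s t‖ :=
    ((M.Φ _).le_opNorm _).trans_lt <|
      mul_lt_mul_of_pos_right (hM.norm_Φ_lt_mass hx) (norm_pos_iff.2 hst)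
  have hinner : -(‖s t‖ * ‖ΦS‖) ≤ (inner ℂ (s t) (Complex.I • ΦS)).re := by
    have h := (Complex.abs_re_le_norm _).trans (norm_inner_le_norm (𝕜 := ℂ) (s t) (Complex.I • ΦS))
    rw [norm_smul, Complex.norm_I, one_mul] at h
    exact (abs_le.1 h).1
  rw [inner_add_right, inner_neg_right, map_add, map_neg, RCLike.re_to_complex,
    RCLike.re_to_complex, hA]
  linear_combination hinner + mul_lt_mul_of_pos_left hΦ (norm_pos_iff.2 hst)

theorem IsDecayingR.isDecayingS_comp_neg {a b : Boundary} {r : ℝ → Fibre}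
    (hr : M.IsDecayingR a b r) : M.IsDecayingS b a (fun t => r (-t)) := by
  constructor
  · intro t
    have hderiv : deriv (geodesic b a) t = -deriv (geodesic a b) (-t) := by
      rw [← deriv_comp_neg, ← funext (geodesic_neg a b)]
    rw [← geodesic_neg, hderiv]
    refine ((hr.1 (-t)).scomp t (hasDerivAt_neg t)).congr_deriv ?_
    rw [map_neg, _root_.neg_apply]
    module
  · simpa [Function.comp_def] using hr.2.comp tendsto_neg_atTop_atBot

theorem norm_pairing_lt_one (hM : M.Nontrivial) {a b : Boundary} (hab : a ≠ b) {r s : ℝ → Fibre}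
    (hr : M.IsDecayingR a b r) (hs : M.IsDecayingS a b s) : ‖pairing r s‖ < 1 := by
  have hr0 : ‖r 0‖ < 1 := by simpa using hr.isDecayingS_comp_neg.norm_lt_one hM hab.symm
  calc ‖pairing r s‖ ≤ ‖r 0‖ * ‖s 0‖ := norm_inner_le_norm _ _
    _ < 1 := mul_lt_one_of_nonneg_of_lt_one_left (norm_nonneg _) hr0 (hs.norm_lt_one hM hab).le

theorem IsNPointValue.norm_lt_one (hM : M.Nontrivial) {n : ℕ} [NeZero n] {z : Fin n → Boundary}
    {c : ℂ} (h : M.IsNPointValue z c) : ‖c‖ < 1 := by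
  obtain ⟨hz, r, s, hr, hs, -, rfl⟩ := h
  rw [norm_prod]
  have hlt : ∀ i, ‖pairing (r i) (s i)‖ < 1 := fun i => norm_pairing_lt_one hM (hz i) (hr i) (hs i)
  rw [← Finset.mul_prod_erase _ _ (Finset.mem_univ 0)]
  exact mul_lt_one_of_nonneg_of_lt_one_left (norm_nonneg _) (hlt 0)
    (Finset.prod_le_one (fun i _ => norm_nonneg _) fun i _ => (hlt i).le)

theorem IsNPointValue.nontrivial {n : ℕ} [NeZero n] {z : Fin n → Boundary} {c : ℂ}
    (h : M.IsNPointValue z c) : {w | w ∈ List.ofFn z}.Nontrivial :=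
  ⟨z 0, List.mem_ofFn.2 ⟨0, rfl⟩, z (0 + 1), List.mem_ofFn.2 ⟨0 + 1, rfl⟩, h.1 0⟩

theorem Expectation.eq_one {l : List Boundary} {c : ℂ} (h : M.Expectation l c)
    (hl : {z | z ∈ l}.Subsingleton) : c = 1 := by
  induction h with
  | generic _ _ h => exact absurd hl h.nontrivial.not_subsingleton
  | one _ => rfl
  | square _ _ _ _ ih => exact ih (by simpa using hl)
  | rotate _ _ _ _ ih => exact ih (by simpa [or_comm] using hl)

theorem Expectation.norm_lt_one (hM : M.Nontrivial) {l : List Boundary} {c : ℂ}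
    (h : M.Expectation l c) (hl : {z | z ∈ l}.Nontrivial) : ‖c‖ < 1 := by
  induction h with
  | generic _ _ h => exact h.norm_lt_one hM
  | one _ => simp at hl
  | square _ _ _ _ ih => exact ih (by simpa using hl)
  | rotate _ _ _ _ ih => exact ih (by simpa [or_comm] using hl)

end HyperbolicMonopole

theorem mainTheorem11_general (M : HyperbolicMonopole) (hM : M.Nontrivial) :
    (∀ (l : List Boundary) (c : ℂ), {z | z ∈ l}.Nontrivial → M.Expectation l c → ‖c‖ < 1) ∧
    (∀ (𝒜 : Type*) [Mul 𝒜] (P : Boundary → 𝒜) (expect : 𝒜 → ℂ),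
      (∀ z w, M.Expectation [z, w] (expect (P z * P w))) → Function.Injective P) := by
  refine ⟨fun l c hl hc => hc.norm_lt_one hM hl, fun 𝒜 _ P expect hexpect z w hP => ?_⟩
  by_contra hzw
  have hdiag : expect (P z * P z) = 1 := (hexpect z z).eq_one (by simp)
  have hoff : ‖expect (P z * P w)‖ < 1 :=
    (hexpect z w).norm_lt_one hM ⟨z, by simp, w, by simp, hzw⟩
  rw [← hP, hdiag, norm_one] at hoff
  exact hoff.false

theorem mainTheorem11 (M : HyperbolicMonopole) (hM : M.Nontrivial) :
    (∀ (n : ℕ) [NeZero n] (z : Fin n → Boundary), (∀ i, z i ≠ z (i + 1)) →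
      ∀ c : ℂ, M.IsNPointValue z c → ‖c‖ < 1) ∧
    (∀ (𝒜 : Type*) [NonUnitalRing 𝒜] [StarRing 𝒜] [Module ℂ 𝒜] [IsScalarTower ℂ 𝒜 𝒜]
      [SMulCommClass ℂ 𝒜 𝒜] [StarModule ℂ 𝒜] (S : ExpectationAlgebra M 𝒜) (z₁ z₂ : Boundary),
      z₁ ≠ z₂ → S.P z₁ ≠ S.P z₂) :=
  have h := mainTheorem11_general M hM
  ⟨fun _ _ z _ c hc => h.1 _ c hc.nontrivial (.generic z c hc), fun 𝒜 _ _ _ _ _ _ S _ _ =>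
    (h.2 𝒜 S.P S.expect fun z w => S.expect_word z [w]).ne⟩
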